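/- Let $\mathsf h \neq \{0\}$ be a finite-dimensional complex Hilbert space and let $\mathcal T=(\mathcal T_t)_{t\ge 0}$ be a quantum Markov semigroup on $\mathcal B(\mathsf h)$, i.e. a weakly$^*$-continuous semigroup ($\mathcal T_0=\mathrm{id}$, $\mathcal T_{s+t}=\mathcal T_s\mathcal T_t$) of completely positive, identity preserving, normal linear maps on $\mathcal B(\mathsf h)$. A density is a positive operator $\rho$ on $\mathsf h$ with $\operatorname{tr}\rho=1$; it is faithful if the closure of its range is $\mathsf h$, and invariant if $\operatorname{tr}(\rho\,\mathcal T_t(x))=\operatorname{tr}(\rho x)$ for all $t\ge 0$ and $x\in\mathcal B(\mathsf h)$. A completely positive map $\Phi$ on $\mathcal B(\mathsf h)$ is irreducible if every orthogonal projection $p$ with $\Phi(p)\ge p$ is $0$ or $\mathbf 1$; the semigroup $\mathcal T$ is irreducible if every orthogonal projection $p$ with $\mathcal T_t(p)\ge p$ for all $t\ge0$ is $0$ or $\mathbf 1$; and $\mathcal T$ is primitive if it has a faithful invariant density which is its only invariant density. Then $\mathcal T$ admits an invariant density, and the following statements are equivalent: 1. $\mathcal T$ is irreducible; 2. $\mathcal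 T$ is primitive; 3. $\mathcal T_{t_0}$ is irreducible for all $t_0>0$; 4. $\mathcal T_{t_0}$ is irreducible for some $t_0>0$. -/

import Mathlib

open scoped NNReal CStarAlgebra Topology

noncomputable section

namespace QuantumMarkov

variable {h : Type*} [NormedAddCommGroup h] [InnerProductSpace ℂ h] [CompleteSpace h]

/-- Irreducibility of a completely positive map on `B(h)`: the only orthogonal projections `p`
with `Φ p ≥ p` (Loewner order) are `0` and the identity. -/
def IsIrreducibleMap (Φ : (h →L[ℂ] h) →CP (h →L[ℂ] h)) : Prop :=
  ∀ p : h →L[ℂ] h, IsStarProjection p → p ≤ Φ p → p = 0 ∨ p = 1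

variable [FiniteDimensional ℂ h]

/-- The trace of an operator on a finite-dimensional Hilbert space. -/
def tr (x : h →L[ℂ] h) : ℂ := LinearMap.trace ℂ h (x : h →ₗ[ℂ] h)

variable (h) in
/-- The weak-star topology on `B(h)`: the coarsest topology that makes `x ↦ tr (η x)` continuous
for all trace class `η`. For finite-dimensional `h` every operator `η` is trace class. -/
abbrev weakStarTopology : TopologicalSpace (h →L[ℂ] h) :=
  TopologicalSpace.induced (fun x η : h →L[ℂ] h => tr (η * x)) Pi.topologicalSpace

variable (h) in
/-- A quantum Markov semigroup on `B(h)`, for `h` finite-dimensional: a weakly-star continuous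
one-parameter semigroup of completely positive, identity preserving, normal maps. -/
structure QMS where
  /-- The completely positive map at time `t`. -/
  map : ℝ≥0 → ((h →L[ℂ] h) →CP (h →L[ℂ] h))
  map_zero : ∀ x, map 0 x = x
  map_add : ∀ s t x, map (s + t) x = map s (map t x)
  map_one : ∀ t, map t 1 = 1
  normal : ∀ t, Continuous[weakStarTopology h, weakStarTopology h] (map t)
  weakStar_continuous : ∀ x, 
    Continuous[NNReal.instTopologicalSpace, weakStarTopology h] fun t : ℝ≥0 => map t x

/-- A density: a positive operator of unit trace. -/
def IsDensity (ρ : h →L[ℂ] h) : Prop := 0 ≤ ρ ∧ tr ρ = 1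

/-- An operator is faithful if its support, the closure of its range, is the whole space. -/
def IsFaithful (ρ : h →L[ℂ] h) : Prop :=
  (LinearMap.range (ρ : h →ₗ[ℂ] h)).topologicalClosure = ⊤

namespace QMS

/-- Invariance of a density `ρ`: `tr (ρ T_t(x)) = tr (ρ x)` for all `t ≥ 0` and all `x`, that is,
the predual semigroup fixes `ρ`. -/
def IsInvariant (T : QMS h) (ρ : h →L[ℂ] h) : Prop :=
  ∀ (t : ℝ≥0) (x : h →L[ℂ] h), tr (ρ * T.map t x) = tr (ρ * x)

/-- Irreducibility of a semigroup: there is no non-trivial common subharmonic projection. -/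
def IsIrreducible (T : QMS h) : Prop :=
  ∀ p : h →L[ℂ] h, IsStarProjection p → (∀ t : ℝ≥0, p ≤ T.map t p) → p = 0 ∨ p = 1

/-- Primitivity: there is an invariant density that is faithful and is the only invariant
density. -/
def IsPrimitive (T : QMS h) : Prop :=
  ∃ ρ : h →L[ℂ] h, IsDensity ρ ∧ T.IsInvariant ρ ∧ IsFaithful ρ ∧
    ∀ σ : h →L[ℂ] h, IsDensity σ → T.IsInvariant σ → σ = ρ

end QMS

end QuantumMarkov

end

/-!
Invariant densities come from the Markov–Kakutani theorem: the predual maps commute and preserve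
the compact convex set of densities, as well as its face of densities supported in a given
subharmonic projection `p`. Applied to that face, this shows that primitive families are
irreducible. Applied on the Heisenberg side, it provides for every `x` a common fixed point `y`
with the same expectation as `x` in every invariant density; for an irreducible family `y` is a
scalar, so the invariant density is unique.

That every `T_{t₀}` with `t₀ > 0` is irreducible is proved by studying an operator `x` with
`T_t x = ψ(t) x` for all `t`, where `ψ(t₀) = 1`. The latter forces `|ψ| = 1`, and then the
Kadison–Schwarz inequality is an equality at `x` because the invariant density is faithful. By
Choi's theorem `T_t (x y) = T_t x * T_t y` for all `y`. Hence the kernel projection of `x` is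
superharmonic, so `x` is invertible, and `T_t (x ^ n) = ψ(t) ^ n x ^ n`. Some power of `x` has
nonzero expectation, and invariance gives `ψ ^ n = 1`. Since every `t` is `n` times `t / n`,
`ψ = 1` and `x` is a scalar. A fixed projection of `T_{t₀}` is therefore trivial.
-/

open Filter Module
open scoped ComplexOrder InnerProductSpace

namespace QuantumMarkov

section FixedPoint

variable {E : Type*} [NormedAddCommGroup E] [NormedSpace ℝ E] {K : Set E}

theorem birkhoffAverage_id_mem {f : E → E} (hK : Convex ℝ K) (hf : Set.MapsTo f K K) {y : E}
    (hy : y ∈ K) (n : ℕ) : birkhoffAverage ℝ f id (n + 1) y ∈ K := by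
  rw [birkhoffAverage, birkhoffSum, Finset.smul_sum]
  refine hK.sum_mem (fun _ _ => by positivity) ?_ fun k _ => hf.iterate k hy
  rw [Finset.sum_const, Finset.card_range, nsmul_eq_mul]
  exact mul_inv_cancel₀ (by positivity)

theorem exists_fixedPoint_of_mapsTo (f : E →L[ℝ] E) (hK : IsCompact K) (hKc : Convex ℝ K)
    (hne : K.Nonempty) (hf : Set.MapsTo f K K) : ∃ x ∈ K, f x = x := by
  obtain ⟨y, hy⟩ := hne
  let a : ℕ → E := fun n => birkhoffAverage ℝ f id (n + 1) y
  obtain ⟨x, hxK, φ, hφ, hlim⟩ := hK.tendsto_subseq (birkhoffAverage_id_mem hKc hf hy)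
  have hbdd : Bornology.IsBounded (Set.range fun k => id (f^[k] y)) :=
    hK.isBounded.subset (Set.range_subset_iff.mpr fun k => hf.iterate k hy)
  have hdiff : Tendsto (fun n => f (a n) - a n) atTop (𝓝 0) := by
    refine ((tendsto_birkhoffAverage_apply_sub_birkhoffAverage ℝ hbdd).comp
      (tendsto_add_atTop_nat 1)).congr fun n => ?_
    have hmap : f (a n) = birkhoffAverage ℝ f id (n + 1) (f y) := by
      simp only [a, birkhoffAverage, birkhoffSum, map_smul, map_sum, id,
        ← Function.iterate_succ_apply, Function.iterate_succ_apply']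
    rw [hmap, Function.comp_apply]
  refine ⟨x, hxK, sub_eq_zero.mp (tendsto_nhds_unique ?_ (hdiff.comp hφ.tendsto_atTop))⟩
  exact ((f.continuous.tendsto x).comp hlim).sub hlim

/-- The Markov–Kakutani theorem. -/
theorem exists_common_fixedPoint_of_mapsTo {ι : Type*} (f : ι → E →L[ℝ] E)
    (hcomm : ∀ i j x, f i (f j x) = f j (f i x)) (hK : IsCompact K) (hKc : Convex ℝ K)
    (hne : K.Nonempty) (hf : ∀ i, Set.MapsTo (f i) K K) : ∃ x ∈ K, ∀ i, f i x = x := by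
  have hclosed : ∀ i, IsClosed {x | f i x = x} := fun i =>
    isClosed_eq (f i).continuous continuous_id
  have hconvex : ∀ i, Convex ℝ {x | f i x = x} := fun i x hx y hy a b _ _ _ => by
    simp_all
  have hfinite : ∀ s : Finset ι, (K ∩ ⋂ i ∈ s, {x | f i x = x}).Nonempty := by
    intro s
    induction s using Finset.cons_induction with
    | empty => simpa using hne
    | cons j s hj ih =>
      obtain ⟨x, ⟨hxK, hxs⟩, hxj⟩ := exists_fixedPoint_of_mapsTo (f j)
        (hK.inter_right (isClosed_biInter fun i _ => hclosed i))
        (hKc.inter (convex_iInter₂ fun i _ => hconvex i)) ih fun x hx => ⟨hf j hx.1, by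
          refine Set.mem_iInter₂.mpr fun i hi => ?_
          have hfix : f i x = x := Set.mem_iInter₂.mp hx.2 i hi
          exact (hcomm i j x).trans (congrArg (f j) hfix)⟩
      exact ⟨x, hxK, by simp_all⟩
  obtain ⟨x, hxK, hx⟩ := hK.inter_iInter_nonempty _ hclosed hfinite
  exact ⟨x, hxK, fun i => (Set.mem_iInter.mp hx i :)⟩

end FixedPoint

theorem exists_common_eigenvector {ι 𝕜 V : Type*} [Field 𝕜] [IsAlgClosed 𝕜] [AddCommGroup V]
    [Module 𝕜 V] [FiniteDimensional 𝕜 V] (f : ι → End 𝕜 V) (hcomm : ∀ i j, Commute (f i) (f j))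
    (W : Submodule 𝕜 V) (hW : W ≠ ⊥) (hmap : ∀ i, ∀ x ∈ W, f i x ∈ W) :
    ∃ x ∈ W, x ≠ 0 ∧ ∀ i, ∃ c : 𝕜, f i x = c • x := by
  -- In a minimal nonzero invariant subspace every `f i` acts as a scalar.
  obtain ⟨M, ⟨hMW, hM0, hMmap⟩, hmin⟩ := wellFounded_lt.has_min
    {W' : Submodule 𝕜 V | W' ≤ W ∧ W' ≠ ⊥ ∧ ∀ i, ∀ x ∈ W', f i x ∈ W'} ⟨W, le_rfl, hW, hmap⟩
  have : Nontrivial M := Submodule.nontrivial_iff_ne_bot.mpr hM0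
  have hscalar : ∀ i, ∃ c, M ≤ (f i).eigenspace c := by
    intro i
    obtain ⟨c, hc⟩ := End.exists_eigenvalue ((f i).restrict (hMmap i))
    obtain ⟨w, hw, hw0⟩ := hc.exists_hasEigenvector
    have hwc : (w : V) ∈ (f i).eigenspace c :=
      End.mem_eigenspace_iff.mpr (congrArg Subtype.val (End.mem_eigenspace_iff.mp hw))
    refine ⟨c, inf_eq_left.mp (eq_of_le_of_not_lt inf_le_left (hmin _ ⟨inf_le_left.trans hMW, ?_,
      fun j x hx => ⟨hMmap j x hx.1, ?_⟩⟩))⟩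
    · exact (Submodule.ne_bot_iff _).mpr ⟨w, ⟨w.2, hwc⟩, by simpa using hw0⟩
    · exact End.mapsTo_genEigenspace_of_comm (hcomm i j) c 1 hx.2
  obtain ⟨x, hxM, hx0⟩ := Submodule.exists_mem_ne_zero_of_ne_bot hM0
  exact ⟨x, hMW hxM, hx0, fun i => (hscalar i).imp fun c hc => End.mem_eigenspace_iff.mp (hc hxM)⟩

theorem exists_linearMap_pow_ne_zero {K A : Type*} [Field K] [Ring A] [Algebra K A]
    [FiniteDimensional K A] {x : A} (hx : IsUnit x) (φ : A →ₗ[K] K) (hφ : φ 1 ≠ 0) :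
    ∃ n ≠ 0, φ (x ^ n) ≠ 0 := by
  have hcoeff : (minpoly K x).coeff 0 ≠ 0 := by
    rw [← minpoly.algHom_eq (Algebra.lmul K A) Algebra.lmul_injective]
    exact LinearMap.minpoly_coeff_zero_of_injective hx.mul_right_injective
  by_contra! hzero
  have hsum : φ (Polynomial.aeval x (minpoly K x)) = (minpoly K x).coeff 0 * φ 1 := by
    rw [Polynomial.aeval_eq_sum_range, map_sum, Finset.sum_eq_single 0]
    · simp
    · exact fun n _ hn => by rw [map_smul, hzero n hn, smul_zero]
    · simp
  rw [minpoly.aeval, map_zero] at hsum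
  exact mul_ne_zero hcoeff hφ hsum.symm

section OrderUnbounded

variable {B : Type*} [NonUnitalCStarAlgebra B] [PartialOrder B] [StarOrderedRing B]

theorem nonpos_of_forall_smul_le {a b : B} (hab : ∀ r : ℝ, 0 < r → r • b ≤ a) : b ≤ 0 := by
  have hlim : Tendsto (fun r : ℝ => r⁻¹ • a) atTop (𝓝 0) := by
    simpa using (tendsto_inv_atTop_zero (𝕜 := ℝ)).smul_const a
  refine ge_of_tendsto hlim ((eventually_gt_atTop 0).mono fun r hr => ?_)
  simpa [hr.ne'] using smul_le_smul_of_nonneg_left (hab r hr) (inv_nonneg.mpr hr.le)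

theorem eq_zero_of_forall_smul_le {a b : B} (hab : ∀ r : ℝ, r • b ≤ a) : b = 0 := by
  refine le_antisymm (nonpos_of_forall_smul_le fun r _ => hab r) (neg_nonpos.mp ?_)
  exact nonpos_of_forall_smul_le fun r _ => by simpa using hab (-r)

theorem eq_zero_of_forall_smul_add_star_le {a b : B}
    (hab : ∀ s : ℂ, s • b + star (s • b) ≤ a) : b = 0 := by
  have hreal : ∀ c : B, (∀ r : ℝ, r • c + star (r • c) ≤ a) → c + star c = 0 := fun c hc =>
    eq_zero_of_forall_smul_le fun r => by simpa only [smul_add, star_smul, star_trivial] using hc r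
  have hre : b + star b = 0 := hreal b fun r => by simpa only [Complex.coe_smul] using hab r
  have him : Complex.I • b + star (Complex.I • b) = 0 := hreal _ fun r => by
    simpa only [mul_smul, Complex.coe_smul] using hab (r * Complex.I)
  have hsub : b - star b = 0 := by
    simpa [Complex.I_ne_zero, ← sub_eq_add_neg, ← smul_sub] using him
  have htwo : (2 : ℂ) • b = 0 := by linear_combination (norm := module) hre + hsub
  exact (smul_eq_zero.mp htwo).resolve_left two_ne_zero

end OrderUnbounded

section CompletelyPositive

theorem cstarMatrix_apply_self_nonneg {n A : Type*} [Fintype n] [NonUnitalCStarAlgebra A]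
    [PartialOrder A] [StarOrderedRing A] {M : CStarMatrix n n A} (hM : 0 ≤ M) (i : n) :
    0 ≤ M i i := by
  rw [StarOrderedRing.nonneg_iff] at hM
  induction hM using AddSubmonoid.closure_induction with
  | mem M hM =>
    obtain ⟨D, rfl⟩ := hM
    change 0 ≤ (star D * D) i i
    rw [CStarMatrix.mul_apply]
    exact Finset.sum_nonneg fun j _ => star_mul_self_nonneg (D j i)
  | zero => exact le_rfl
  | add M N _ _ hM hN => exact add_nonneg hM hN

section Unital

variable {A B : Type*} [CStarAlgebra A] [CStarAlgebra B] [PartialOrder A] [PartialOrder B]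
  [StarOrderedRing A] [StarOrderedRing B] {Φ : A →CP B}

/-- The Kadison–Schwarz inequality. -/
theorem map_mul_star_map_le (hΦ : Φ 1 = 1) (x : A) : Φ x * star (Φ x) ≤ Φ (x * star x) := by
  let R : CStarMatrix (Fin 2) (Fin 2) A := CStarMatrix.ofMatrix !![1, star x; 0, 0]
  let C : CStarMatrix (Fin 2) (Fin 2) B := CStarMatrix.ofMatrix !![-star (Φ x), 0; 1, 0]
  have hnonneg : 0 ≤ star C * (star R * R).map Φ * C :=
    star_left_conjugate_nonneg (Φ.map_cstarMatrix_nonneg _ (star_mul_self_nonneg R)) C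
  have hentry : (star C * (star R * R).map Φ * C) 0 0 = Φ (x * star x) - Φ x * star (Φ x) := by
    simp [CStarMatrix.mul_apply, CStarMatrix.star_apply, R, C, Fin.sum_univ_two, hΦ, map_star,
      CStarMatrix.map_apply, sub_eq_neg_add]
  exact sub_nonneg.mp (hentry ▸ cstarMatrix_apply_self_nonneg hnonneg 0)

theorem norm_map_le (hΦ : Φ 1 = 1) (x : A) : ‖Φ x‖ ≤ ‖x‖ := by
  have hle : Φ x * star (Φ x) ≤ algebraMap ℝ B ‖x * star x‖ := calc
    Φ x * star (Φ x) ≤ Φ (x * star x) := map_mul_star_map_le hΦ x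
    _ ≤ Φ (algebraMap ℝ A ‖x * star x‖) :=
      OrderHomClass.mono Φ (IsSelfAdjoint.mul_star_self x).le_algebraMap_norm_self
    _ = algebraMap ℝ B ‖x * star x‖ := by
      rw [Algebra.algebraMap_eq_smul_one, Algebra.algebraMap_eq_smul_one, ← Complex.coe_smul,
        map_smul, hΦ, Complex.coe_smul]
  refine abs_le_of_sq_le_sq' ?_ (norm_nonneg x) |>.2
  rwa [← CStarAlgebra.norm_le_iff_le_algebraMap _ (norm_nonneg _) (mul_star_self_nonneg _),
    CStarRing.norm_self_mul_star, CStarRing.norm_self_mul_star, ← sq, ← sq] at hle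

/-- Choi's theorem on multiplicative domains. -/
theorem map_mul_of_map_mul_star_self (hΦ : Φ 1 = 1) {x : A}
    (hx : Φ (x * star x) = Φ x * star (Φ x)) (y : A) : Φ (x * y) = Φ x * Φ y := by
  -- The defect `Φ (z * star z) - Φ z * star (Φ z)` at `z = star y - s • x` is nonnegative and
  -- affine in `s`, because its quadratic part is the defect at `x`.
  refine sub_eq_zero.mp (eq_zero_of_forall_smul_add_star_le
    (a := Φ (star y * y) - star (Φ y) * Φ y) fun s => ?_)
  have hdefect := map_mul_star_map_le hΦ (star y - s • x)
  simp only [star_sub, star_smul, sub_mul, mul_sub, map_sub, map_smul, smul_mul_assoc,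
    mul_smul_comm, map_star, star_star, star_mul, hx] at hdefect ⊢
  have hstar : Φ (star y * star x) = star (Φ (x * y)) := by rw [← star_mul, map_star]
  rw [hstar] at hdefect
  rw [← sub_nonneg] at hdefect ⊢
  refine hdefect.trans_eq ?_
  module

end Unital

end CompletelyPositive

section Trace

variable {h : Type*} [NormedAddCommGroup h] [InnerProductSpace ℂ h]

theorem tr_mul_comm (x y : h →L[ℂ] h) : tr (x * y) = tr (y * x) :=
  LinearMap.trace_mul_comm ℂ (x : h →ₗ[ℂ] h) y

theorem tr_zero : tr (0 : h →L[ℂ] h) = 0 := by simp [tr]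

theorem tr_add (x y : h →L[ℂ] h) : tr (x + y) = tr x + tr y := by simp [tr]

theorem tr_sub (x y : h →L[ℂ] h) : tr (x - y) = tr x - tr y := by simp [tr]

theorem tr_smul (c : ℂ) (x : h →L[ℂ] h) : tr (c • x) = c * tr x := by simp [tr]

/-- The trace pairing `(ρ, x) ↦ tr (ρ x)`, which identifies `B(h)` with its own (pre)dual. -/
noncomputable def traceForm : LinearMap.BilinForm ℂ (h →L[ℂ] h) :=
  (LinearMap.mul ℂ (h →L[ℂ] h)).compr₂ (LinearMap.trace ℂ h ∘ₗ ContinuousLinearMap.coeLM ℂ)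

theorem traceForm_apply (ρ x : h →L[ℂ] h) : traceForm ρ x = tr (ρ * x) := rfl

theorem IsDensity.ne_zero {ρ : h →L[ℂ] h} (hρ : IsDensity ρ) : ρ ≠ 0 := by
  rintro rfl
  simpa [tr_zero] using hρ.2

section FiniteDimensional

variable [FiniteDimensional ℂ h]

theorem continuous_tr_mul_right (x : h →L[ℂ] h) : Continuous fun ρ => tr (ρ * x) :=
  (traceForm.flip x).continuous_of_finiteDimensional

theorem tr_mul_rankOne (x : h →L[ℂ] h) (u v : h) :
    tr (x * InnerProductSpace.rankOne ℂ u v) = ⟪v, x u⟫_ℂ := by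
  have hmul : x * InnerProductSpace.rankOne ℂ u v = InnerProductSpace.rankOne ℂ (x u) v := by
    ext w; simp
  rw [hmul]
  exact InnerProductSpace.trace_rankOne (x u) v

theorem nonneg_of_forall_tr_mul_nonneg {x : h →L[ℂ] h} (hx : ∀ a, 0 ≤ a → 0 ≤ tr (x * a)) :
    0 ≤ x := by
  rw [ContinuousLinearMap.nonneg_iff_isPositive, ContinuousLinearMap.isPositive_iff_complex]
  intro v
  have hinner : 0 ≤ ⟪x v, v⟫_ℂ := by
    rw [← inner_conj_symm, ← tr_mul_rankOne]
    exact star_nonneg_iff.mpr (hx _ ((ContinuousLinearMap.nonneg_iff_isPositive _).mpr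
      (InnerProductSpace.isPositive_rankOne_self v)))
  obtain ⟨hre, him⟩ := Complex.nonneg_iff.mp hinner
  exact ⟨Complex.ext rfl him, hre⟩

end FiniteDimensional

variable [CompleteSpace h]

theorem tr_star_mul_self_mul_star_mul_self (x y : h →L[ℂ] h) :
    tr ((star x * x) * (star y * y)) = tr (star (x * star y) * (x * star y)) := by
  rw [star_mul, star_star, ← mul_assoc, tr_mul_comm]
  simp only [mul_assoc]

theorem convex_setOf_isDensity : Convex ℝ {ρ : h →L[ℂ] h | IsDensity ρ} := by
  rintro ρ ⟨hρ, hρtr⟩ σ ⟨hσ, hσtr⟩ a b ha hb hab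
  refine ⟨add_nonneg (smul_nonneg ha hρ) (smul_nonneg hb hσ), ?_⟩
  rw [← Complex.coe_smul, ← Complex.coe_smul, tr_add, tr_smul, tr_smul, hρtr, hσtr]
  exact_mod_cast (by simpa using hab)

variable [FiniteDimensional ℂ h]

theorem tr_star_mul_self (x : h →L[ℂ] h) :
    tr (star x * x) = ((∑ i, ‖x (stdOrthonormalBasis ℂ h i)‖ ^ 2 : ℝ) : ℂ) := by
  rw [tr, LinearMap.trace_eq_sum_inner _ (stdOrthonormalBasis ℂ h)]
  push_cast
  refine Finset.sum_congr rfl fun i _ => ?_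
  simp [ContinuousLinearMap.star_eq_adjoint, ContinuousLinearMap.adjoint_inner_right,
    inner_self_eq_norm_sq_to_K]

theorem tr_star_mul_self_eq_zero {x : h →L[ℂ] h} (hx : tr (star x * x) = 0) : x = 0 := by
  rw [tr_star_mul_self, Complex.ofReal_eq_zero,
    Finset.sum_eq_zero_iff_of_nonneg fun _ _ => by positivity] at hx
  refine ContinuousLinearMap.coe_injective
    ((stdOrthonormalBasis ℂ h).toBasis.ext fun i => ?_)
  simpa using hx i (Finset.mem_univ i)

theorem tr_nonneg {x : h →L[ℂ] h} (hx : 0 ≤ x) : 0 ≤ tr x := by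
  obtain ⟨y, rfl⟩ := CStarAlgebra.nonneg_iff_eq_star_mul_self.mp hx
  rw [tr_star_mul_self]
  exact_mod_cast Finset.sum_nonneg fun _ _ => by positivity

theorem tr_mul_nonneg {x y : h →L[ℂ] h} (hx : 0 ≤ x) (hy : 0 ≤ y) : 0 ≤ tr (x * y) := by
  obtain ⟨a, rfl⟩ := CStarAlgebra.nonneg_iff_eq_star_mul_self.mp hx
  obtain ⟨b, rfl⟩ := CStarAlgebra.nonneg_iff_eq_star_mul_self.mp hy
  rw [tr_star_mul_self_mul_star_mul_self]
  exact tr_nonneg (star_mul_self_nonneg _)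

theorem mul_eq_zero_of_tr_mul_eq_zero {x y : h →L[ℂ] h} (hx : 0 ≤ x) (hy : 0 ≤ y)
    (hxy : tr (x * y) = 0) : x * y = 0 := by
  obtain ⟨a, rfl⟩ := CStarAlgebra.nonneg_iff_eq_star_mul_self.mp hx
  obtain ⟨b, rfl⟩ := CStarAlgebra.nonneg_iff_eq_star_mul_self.mp hy
  rw [tr_star_mul_self_mul_star_mul_self] at hxy
  rw [mul_assoc, ← mul_assoc a, tr_star_mul_self_eq_zero hxy, zero_mul, mul_zero]

theorem tr_mul_le_tr_mul {x a b : h →L[ℂ] h} (hx : 0 ≤ x) (hab : a ≤ b) :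
    tr (x * a) ≤ tr (x * b) := by
  rw [← sub_nonneg, ← tr_sub, ← mul_sub]
  exact tr_mul_nonneg hx (sub_nonneg.mpr hab)

theorem eq_of_le_of_tr_mul_le {x a b : h →L[ℂ] h} (hx : 0 ≤ x) (hu : IsUnit x) (hab : a ≤ b)
    (hle : tr (x * b) ≤ tr (x * a)) : a = b := by
  have htr : tr (x * (b - a)) = 0 := by
    rw [mul_sub, tr_sub, sub_eq_zero]
    exact le_antisymm hle (tr_mul_le_tr_mul hx hab)
  have hmul := mul_eq_zero_of_tr_mul_eq_zero hx (sub_nonneg.mpr hab) htr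
  exact (sub_eq_zero.mp (hu.mul_right_eq_zero.mp hmul)).symm

theorem isFaithful_iff_isUnit {ρ : h →L[ℂ] h} : IsFaithful ρ ↔ IsUnit ρ := by
  rw [IsFaithful, (Submodule.closed_of_finiteDimensional _).submodule_topologicalClosure_eq,
    ContinuousLinearMap.isUnit_iff_bijective, LinearMap.range_eq_top]
  exact ⟨fun hs => ⟨LinearMap.injective_iff_surjective.mpr hs, hs⟩, fun hb => hb.2⟩

theorem IsDensity.norm_le_one {ρ : h →L[ℂ] h} (hρ : IsDensity ρ) : ‖ρ‖ ≤ 1 := by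
  obtain ⟨hnonneg, htr⟩ := hρ
  obtain ⟨c, rfl⟩ := CStarAlgebra.nonneg_iff_eq_star_mul_self.mp hnonneg
  have hc : ‖c‖ ≤ 1 := ContinuousLinearMap.opNorm_le_of_unit_norm zero_le_one fun v hv => by
    have hle : tr (star c * c * InnerProductSpace.rankOne ℂ v v) ≤ tr (star c * c * 1) :=
      tr_mul_le_tr_mul hnonneg (InnerProductSpace.isStarProjection_rankOne_self hv).le_one
    rw [tr_mul_rankOne, mul_one, htr, mul_apply_eq_comp,
      ContinuousLinearMap.star_eq_adjoint, ContinuousLinearMap.adjoint_inner_right,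
      inner_self_eq_norm_sq_to_K] at hle
    have hsq : ‖c v‖ ^ 2 ≤ 1 := Complex.real_le_real.mp (by simpa using hle)
    exact (sq_le_one_iff₀ (norm_nonneg _)).mp hsq
  rw [CStarRing.norm_star_mul_self]
  exact mul_le_one₀ hc (norm_nonneg c) hc

theorem isCompact_setOf_isDensity : IsCompact {ρ : h →L[ℂ] h | IsDensity ρ} := by
  have : ProperSpace (h →L[ℂ] h) := FiniteDimensional.proper ℂ _
  refine Metric.isCompact_of_isClosed_isBounded ?_ ?_
  · have htr : Continuous fun ρ : h →L[ℂ] h => tr ρ := by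
      simpa only [mul_one] using continuous_tr_mul_right (h := h) 1
    exact (isClosed_le continuous_const continuous_id).inter (isClosed_eq htr continuous_const)
  · exact isBounded_iff_forall_norm_le.mpr ⟨1, fun _ hρ => hρ.norm_le_one⟩

theorem isDensity_inv_tr_smul {x : h →L[ℂ] h} (hx : 0 ≤ x) (hx0 : x ≠ 0) :
    IsDensity ((tr x)⁻¹ • x) := by
  have htr : tr x ≠ 0 := fun h0 => hx0 (by
    simpa using mul_eq_zero_of_tr_mul_eq_zero hx zero_le_one (by rwa [mul_one]))
  exact ⟨smul_nonneg (inv_nonneg.mpr (tr_nonneg hx)) hx, by rw [tr_smul, inv_mul_cancel₀ htr]⟩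

theorem eq_of_forall_tr_mul_eq {ρ σ : h →L[ℂ] h} (heq : ∀ x, tr (ρ * x) = tr (σ * x)) : ρ = σ := by
  refine sub_eq_zero.mp (star_eq_zero.mp (tr_star_mul_self_eq_zero ?_))
  rw [star_star, sub_mul, tr_sub, heq, sub_self]

theorem traceForm_nondegenerate : (traceForm (h := h)).Nondegenerate :=
  LinearMap.BilinForm.Nondegenerate.ofSeparatingLeft fun ρ hρ =>
    eq_of_forall_tr_mul_eq fun x => by rw [zero_mul, tr_zero]; exact hρ x

/-- The predual (Schrödinger picture) of a map `Φ` on `B(h)`, characterized by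
`tr (predual Φ ρ * x) = tr (ρ * Φ x)`. -/
noncomputable def predual (Φ : (h →L[ℂ] h) →CP (h →L[ℂ] h)) : End ℂ (h →L[ℂ] h) :=
  traceForm.leftAdjointOfNondegenerate traceForm_nondegenerate Φ.toLinearMap

theorem tr_predual_mul (Φ : (h →L[ℂ] h) →CP (h →L[ℂ] h)) (ρ x : h →L[ℂ] h) :
    tr (predual Φ ρ * x) = tr (ρ * Φ x) :=
  traceForm.isAdjointPairLeftAdjointOfNondegenerate traceForm_nondegenerate Φ.toLinearMap ρ x

theorem isDensity_predual {Φ : (h →L[ℂ] h) →CP (h →L[ℂ] h)} (hΦ : Φ 1 = 1) {ρ : h →L[ℂ] h}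
    (hρ : IsDensity ρ) : IsDensity (predual Φ ρ) := by
  refine ⟨nonneg_of_forall_tr_mul_nonneg fun a ha => ?_, ?_⟩
  · rw [tr_predual_mul]
    exact tr_mul_nonneg hρ.1 (map_nonneg Φ ha)
  · rw [← mul_one (predual Φ ρ), tr_predual_mul, hΦ, mul_one, hρ.2]

end Trace

section KernelProjection

variable {h : Type*} [NormedAddCommGroup h] [InnerProductSpace ℂ h] [CompleteSpace h]

theorem le_of_isStarProjection_mul_eq {p y : h →L[ℂ] h} (hp : IsStarProjection p) (hy : 0 ≤ y)
    (hy1 : y ≤ 1) (hpy : p * y = y) : y ≤ p := by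
  have hyp : y * p = y := by
    simpa [hp.isSelfAdjoint.star_eq, (IsSelfAdjoint.of_nonneg hy).star_eq] using congrArg star hpy
  have hle := star_left_conjugate_le_conjugate hy1 p
  rwa [hp.isSelfAdjoint.star_eq, hpy, hyp, mul_one, hp.isIdempotentElem.eq] at hle

/-- The orthogonal projection onto the kernel of an operator; for positive operators, the
complement of the support projection. -/
noncomputable def kerProj (x : h →L[ℂ] h) : h →L[ℂ] h :=
  (LinearMap.ker (x : h →ₗ[ℂ] h)).starProjection

theorem mul_kerProj (x : h →L[ℂ] h) : x * kerProj x = 0 := by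
  ext v
  exact ((LinearMap.ker (x : h →ₗ[ℂ] h)).starProjection_apply_mem v :)

theorem isStarProjection_kerProj (x : h →L[ℂ] h) : IsStarProjection (kerProj x) :=
  isStarProjection_starProjection

theorem le_kerProj {x y : h →L[ℂ] h} (hy : 0 ≤ y) (hy1 : y ≤ 1) (hxy : x * y = 0) :
    y ≤ kerProj x := by
  refine le_of_isStarProjection_mul_eq (isStarProjection_kerProj x) hy hy1 ?_
  ext v
  exact Submodule.starProjection_eq_self_iff.mpr (DFunLike.congr_fun hxy v)

theorem isUnit_of_kerProj_eq_zero [FiniteDimensional ℂ h] {x : h →L[ℂ] h} (hx : kerProj x = 0) :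
    IsUnit x := by
  rw [kerProj, ← Submodule.starProjection_bot, Submodule.starProjection_inj,
    LinearMap.ker_eq_bot] at hx
  rw [ContinuousLinearMap.isUnit_iff_bijective]
  exact ⟨hx, LinearMap.surjective_of_injective hx⟩

end KernelProjection

section CommutingFamily

variable {h : Type*} [NormedAddCommGroup h] [InnerProductSpace ℂ h] [CompleteSpace h] {ι : Type*}

/-- An operator whose pairing with `B(h)` is preserved by every map of the family, i.e. a common
fixed point of the preduals. -/
def IsInvariantUnder (Φ : ι → (h →L[ℂ] h) →CP (h →L[ℂ] h)) (ρ : h →L[ℂ] h) : Prop :=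
  ∀ i x, tr (ρ * Φ i x) = tr (ρ * x)

/-- Irreducibility of a family of completely positive maps: there is no non-trivial common
subharmonic projection. -/
def IsIrreducibleFamily (Φ : ι → (h →L[ℂ] h) →CP (h →L[ℂ] h)) : Prop :=
  ∀ p : h →L[ℂ] h, IsStarProjection p → (∀ i, p ≤ Φ i p) → p = 0 ∨ p = 1

/-- Primitivity of a family of completely positive maps: it has a faithful invariant density,
which is its only invariant density. -/
def IsPrimitiveFamily (Φ : ι → (h →L[ℂ] h) →CP (h →L[ℂ] h)) : Prop :=
  ∃ ρ, IsDensity ρ ∧ IsInvariantUnder Φ ρ ∧ IsFaithful ρ ∧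
    ∀ σ, IsDensity σ → IsInvariantUnder Φ σ → σ = ρ

variable [FiniteDimensional ℂ h] {Φ : ι → (h →L[ℂ] h) →CP (h →L[ℂ] h)}

theorem exists_isInvariantUnder_of_subharmonic (hcomm : ∀ i j x, Φ i (Φ j x) = Φ j (Φ i x))
    (hone : ∀ i, Φ i 1 = 1) {p : h →L[ℂ] h} (hp : IsStarProjection p) (hp0 : p ≠ 0)
    (hsub : ∀ i, p ≤ Φ i p) :
    ∃ ρ, IsDensity ρ ∧ IsInvariantUnder Φ ρ ∧ tr (ρ * (1 - p)) = 0 := by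
  let K : Set (h →L[ℂ] h) := {ρ | IsDensity ρ} ∩ {ρ | tr (ρ * (1 - p)) = 0}
  have hK : IsCompact K := isCompact_setOf_isDensity.inter_right
    (isClosed_eq (continuous_tr_mul_right _) continuous_const)
  have hKc : Convex ℝ K := convex_setOf_isDensity.inter
    ((LinearMap.ker (traceForm.flip (1 - p))).restrictScalars ℝ).convex
  have hne : K.Nonempty := ⟨(tr p)⁻¹ • p, isDensity_inv_tr_smul hp.nonneg hp0, by
    simp [mul_sub, hp.isIdempotentElem.eq, tr_zero]⟩
  have hmaps : ∀ i, Set.MapsTo (predual (Φ i)) K K := fun i ρ ⟨hρ, hρp⟩ => by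
    refine ⟨isDensity_predual (hone i) hρ, le_antisymm ?_ ?_⟩
    · rw [tr_predual_mul, map_sub, hone]
      exact (tr_mul_le_tr_mul hρ.1 (sub_le_sub_left (hsub i) 1)).trans_eq hρp
    · exact tr_mul_nonneg (isDensity_predual (hone i) hρ).1 hp.one_sub.nonneg
  obtain ⟨ρ, ⟨hρ, hρp⟩, hfix⟩ := exists_common_fixedPoint_of_mapsTo
    (fun i => (LinearMap.toContinuousLinearMap (predual (Φ i))).restrictScalars ℝ)
    (fun i j ρ => eq_of_forall_tr_mul_eq fun x => by simp [tr_predual_mul, hcomm i j])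
    hK hKc hne hmaps
  refine ⟨ρ, hρ, fun i x => ?_, hρp⟩
  rw [← tr_predual_mul]
  exact congrArg (fun σ => tr (σ * x)) (hfix i)

theorem exists_isDensity_isInvariantUnder [Nontrivial h]
    (hcomm : ∀ i j x, Φ i (Φ j x) = Φ j (Φ i x)) (hone : ∀ i, Φ i 1 = 1) :
    ∃ ρ, IsDensity ρ ∧ IsInvariantUnder Φ ρ := by
  obtain ⟨ρ, hρ, hinv, -⟩ := exists_isInvariantUnder_of_subharmonic hcomm hone
    (.one _) one_ne_zero fun i => (hone i).ge
  exact ⟨ρ, hρ, hinv⟩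

theorem exists_fixedPoint_tr_mul_eq (hcomm : ∀ i j x, Φ i (Φ j x) = Φ j (Φ i x))
    (hone : ∀ i, Φ i 1 = 1) (x : h →L[ℂ] h) :
    ∃ y, (∀ i, Φ i y = y) ∧ ∀ ρ, IsInvariantUnder Φ ρ → tr (ρ * y) = tr (ρ * x) := by
  have : ProperSpace (h →L[ℂ] h) := FiniteDimensional.proper ℂ _
  let L : Set (h →L[ℂ] h) := ⋂ ρ ∈ {ρ | IsInvariantUnder Φ ρ}, traceForm ρ ⁻¹' {tr (ρ * x)}
  have hL : IsClosed L := isClosed_biInter fun ρ _ =>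
    isClosed_singleton.preimage (traceForm ρ).continuous_of_finiteDimensional
  have hLc : Convex ℝ L := convex_iInter₂ fun ρ _ =>
    (convex_singleton _).linear_preimage ((traceForm ρ).restrictScalars ℝ)
  have hmem : ∀ {y}, y ∈ L ↔ ∀ ρ, IsInvariantUnder Φ ρ → tr (ρ * y) = tr (ρ * x) :=
    Set.mem_iInter₂
  obtain ⟨y, ⟨-, hy⟩, hfix⟩ := exists_common_fixedPoint_of_mapsTo
    (K := Metric.closedBall 0 ‖x‖ ∩ L)
    (fun i => (LinearMap.toContinuousLinearMap (Φ i).toLinearMap).restrictScalars ℝ) hcomm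
    ((isCompact_closedBall _ _).inter_right hL) ((convex_closedBall _ _).inter hLc)
    ⟨x, by simp, hmem.mpr fun _ _ => rfl⟩
    fun i y ⟨hyx, hyL⟩ => ⟨by
      rw [mem_closedBall_zero_iff] at hyx ⊢
      exact (norm_map_le (hone i) y).trans hyx,
    hmem.mpr fun ρ hρ => (hρ i y).trans (hmem.mp hyL ρ hρ)⟩
  exact ⟨y, hfix, hmem.mp hy⟩

theorem IsIrreducibleFamily.eq_zero_or_isUnit (hΦ : IsIrreducibleFamily Φ)
    (hone : ∀ i, Φ i 1 = 1) {x : h →L[ℂ] h} (hx : ∀ i, x * Φ i (kerProj x) = 0) :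
    x = 0 ∨ IsUnit x := by
  have hp := isStarProjection_kerProj x
  have hsuper : ∀ i, Φ i (kerProj x) ≤ kerProj x := fun i =>
    le_kerProj (map_nonneg (Φ i) hp.nonneg) (hone i ▸ OrderHomClass.mono (Φ i) hp.le_one) (hx i)
  rcases hΦ _ hp.one_sub fun i => by
    rw [map_sub, hone]
    exact sub_le_sub_left (hsuper i) 1 with h0 | h1
  · refine Or.inl ?_
    simpa only [← sub_eq_zero.mp h0, mul_one] using mul_kerProj x
  · exact Or.inr (isUnit_of_kerProj_eq_zero (sub_eq_self.mp h1))

theorem IsIrreducibleFamily.isUnit_of_isDensity (hΦ : IsIrreducibleFamily Φ)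
    (hone : ∀ i, Φ i 1 = 1) {ρ : h →L[ℂ] h} (hρ : IsDensity ρ) (hinv : IsInvariantUnder Φ ρ) :
    IsUnit ρ :=
  (hΦ.eq_zero_or_isUnit hone fun i => mul_eq_zero_of_tr_mul_eq_zero hρ.1
    (map_nonneg (Φ i) (isStarProjection_kerProj ρ).nonneg)
    (by rw [hinv, mul_kerProj, tr_zero])).resolve_left hρ.ne_zero

theorem map_mul_of_map_eq_smul {Ψ : (h →L[ℂ] h) →CP (h →L[ℂ] h)} (hΨ : Ψ 1 = 1)
    {ρ : h →L[ℂ] h} (hρ : 0 ≤ ρ) (hu : IsUnit ρ) (hinv : ∀ y, tr (ρ * Ψ y) = tr (ρ * y)) {c : ℂ}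
    (hc : ‖c‖ = 1) {x : h →L[ℂ] h} (hx : Ψ x = c • x) (y : h →L[ℂ] h) :
    Ψ (x * y) = Ψ x * Ψ y := by
  have hmod : Ψ x * star (Ψ x) = x * star x := by
    rw [hx, star_smul, smul_mul_smul_comm, RCLike.star_def, Complex.mul_conj', hc]
    simp
  refine map_mul_of_map_mul_star_self hΨ (eq_of_le_of_tr_mul_le hρ hu ?_ ?_).symm y
  · exact map_mul_star_map_le hΨ x
  · rw [hinv, hmod]

theorem map_pow_of_map_eq_smul {Ψ : (h →L[ℂ] h) →CP (h →L[ℂ] h)} (hΨ : Ψ 1 = 1)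
    {ρ : h →L[ℂ] h} (hρ : 0 ≤ ρ) (hu : IsUnit ρ) (hinv : ∀ y, tr (ρ * Ψ y) = tr (ρ * y)) {c : ℂ}
    (hc : ‖c‖ = 1) {x : h →L[ℂ] h} (hx : Ψ x = c • x) (n : ℕ) : Ψ (x ^ n) = c ^ n • x ^ n := by
  induction n with
  | zero => simpa using hΨ
  | succ n ih =>
    rw [pow_succ', map_mul_of_map_eq_smul hΨ hρ hu hinv hc hx, hx, ih, smul_mul_smul_comm,
      ← pow_succ']

variable {ρ : h →L[ℂ] h} {c : ι → ℂ} {x : h →L[ℂ] h}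

theorem IsIrreducibleFamily.isUnit_of_map_eq_smul (hΦ : IsIrreducibleFamily Φ)
    (hone : ∀ i, Φ i 1 = 1) (hρ : IsDensity ρ) (hinv : IsInvariantUnder Φ ρ)
    (hc : ∀ i, ‖c i‖ = 1) (hx : ∀ i, Φ i x = c i • x) (hx0 : x ≠ 0) : IsUnit x := by
  refine (hΦ.eq_zero_or_isUnit hone fun i => ?_).resolve_left hx0
  have hci : c i ≠ 0 := norm_ne_zero_iff.mp (by simp [hc i])
  have hmul := map_mul_of_map_eq_smul (hone i) hρ.1 (hΦ.isUnit_of_isDensity hone hρ hinv) (hinv i)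
    (hc i) (hx i) (kerProj x)
  rw [mul_kerProj, map_zero, hx, smul_mul_assoc, eq_comm] at hmul
  exact (smul_eq_zero.mp hmul).resolve_left hci

theorem IsIrreducibleFamily.exists_pow_eq_one (hΦ : IsIrreducibleFamily Φ)
    (hone : ∀ i, Φ i 1 = 1) (hρ : IsDensity ρ) (hinv : IsInvariantUnder Φ ρ)
    (hc : ∀ i, ‖c i‖ = 1) (hx : ∀ i, Φ i x = c i • x) (hx0 : x ≠ 0) :
    ∃ n ≠ 0, ∀ i, c i ^ n = 1 := by
  have hxu := hΦ.isUnit_of_map_eq_smul hone hρ hinv hc hx hx0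
  obtain ⟨n, hn, htr⟩ := exists_linearMap_pow_ne_zero hxu (traceForm ρ)
    (by rw [traceForm_apply, mul_one, hρ.2]; exact one_ne_zero)
  refine ⟨n, hn, fun i => mul_eq_right₀ htr |>.mp ?_⟩
  have hpow := map_pow_of_map_eq_smul (hone i) hρ.1 (hΦ.isUnit_of_isDensity hone hρ hinv) (hinv i)
    (hc i) (hx i) n
  rw [traceForm_apply, ← tr_smul, ← mul_smul_comm, ← hpow, hinv]

theorem IsIrreducibleFamily.exists_eq_smul_one [Nontrivial h] (hΦ : IsIrreducibleFamily Φ)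
    (hone : ∀ i, Φ i 1 = 1) (hρ : IsDensity ρ) (hinv : IsInvariantUnder Φ ρ)
    (hx : ∀ i, Φ i x = x) : ∃ a : ℂ, x = a • 1 := by
  obtain ⟨a, ha⟩ := spectrum.nonempty_of_isAlgClosed_of_finiteDimensional ℂ x
  refine ⟨a, by_contra fun hne => ha ?_⟩
  rw [spectrum.mem_resolventSet_iff, ← neg_sub, Algebra.algebraMap_eq_smul_one, IsUnit.neg_iff]
  exact hΦ.isUnit_of_map_eq_smul (c := fun _ => 1) hone hρ hinv (fun _ => norm_one)
    (fun i => by rw [map_sub, map_smul, hone, hx, one_smul]) (sub_ne_zero.mpr hne)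

theorem IsIrreducibleFamily.eq_of_isInvariantUnder [Nontrivial h] (hΦ : IsIrreducibleFamily Φ)
    (hcomm : ∀ i j x, Φ i (Φ j x) = Φ j (Φ i x)) (hone : ∀ i, Φ i 1 = 1) {σ : h →L[ℂ] h}
    (hρ : IsDensity ρ) (hρi : IsInvariantUnder Φ ρ) (hσ : IsDensity σ)
    (hσi : IsInvariantUnder Φ σ) : ρ = σ := by
  refine eq_of_forall_tr_mul_eq fun x => ?_
  obtain ⟨y, hfix, htr⟩ := exists_fixedPoint_tr_mul_eq hcomm hone x
  obtain ⟨a, rfl⟩ := hΦ.exists_eq_smul_one hone hρ hρi hfix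
  rw [← htr ρ hρi, ← htr σ hσi, mul_smul_comm, mul_smul_comm, tr_smul, tr_smul, mul_one, mul_one,
    hρ.2, hσ.2]

theorem isIrreducibleFamily_iff_isPrimitiveFamily [Nontrivial h]
    (hcomm : ∀ i j x, Φ i (Φ j x) = Φ j (Φ i x)) (hone : ∀ i, Φ i 1 = 1) :
    IsIrreducibleFamily Φ ↔ IsPrimitiveFamily Φ := by
  constructor
  · intro hΦ
    obtain ⟨ρ, hρ, hinv⟩ := exists_isDensity_isInvariantUnder hcomm hone
    exact ⟨ρ, hρ, hinv, isFaithful_iff_isUnit.mpr (hΦ.isUnit_of_isDensity hone hρ hinv),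
      fun σ hσ hσi => hΦ.eq_of_isInvariantUnder hcomm hone hσ hσi hρ hinv⟩
  · rintro ⟨ρ, -, -, hfaith, huniq⟩ p hp hsub
    refine or_iff_not_imp_left.mpr fun hp0 => ?_
    obtain ⟨σ, hσ, hσi, hσp⟩ := exists_isInvariantUnder_of_subharmonic hcomm hone hp hp0 hsub
    obtain rfl := huniq σ hσ hσi
    have hmul := mul_eq_zero_of_tr_mul_eq_zero hσ.1 hp.one_sub.nonneg hσp
    exact (sub_eq_zero.mp ((isFaithful_iff_isUnit.mp hfaith).mul_right_eq_zero.mp hmul)).symm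

end CommutingFamily

section Character

theorem norm_addChar_eq_one {M : Type*} [AddCommMonoid M] [PartialOrder M]
    [Archimedean M] [ExistsAddOfLE M] {ψ : AddChar M ℂ} (hψ : ∀ t, ‖ψ t‖ ≤ 1)
    {t₀ : M} (ht₀ : 0 < t₀) (hψ₀ : ψ t₀ = 1) (t : M) : ‖ψ t‖ = 1 := by
  obtain ⟨n, hn⟩ := Archimedean.arch t ht₀
  obtain ⟨s, hs⟩ := exists_add_of_le hn
  have hmul : ‖ψ t‖ * ‖ψ s‖ = 1 := by
    rw [← norm_mul, ← ψ.map_add_eq_mul, ← hs, ψ.map_nsmul_eq_pow, hψ₀, one_pow, norm_one]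
  exact le_antisymm (hψ t) (hmul ▸ mul_le_of_le_one_right (norm_nonneg _) (hψ s))

theorem addChar_eq_one_of_forall_pow_eq_one {R : Type*} [CommMonoid R] {ψ : AddChar ℝ≥0 R} {n : ℕ}
    (hn : n ≠ 0) (hψ : ∀ t, ψ t ^ n = 1) : ψ = 1 := by
  ext t
  have hdiv : n • (t / n) = t := by
    rw [nsmul_eq_mul, mul_div_cancel₀ _ (Nat.cast_ne_zero.mpr hn)]
  rw [← hdiv, ψ.map_nsmul_eq_pow, hψ, AddChar.one_apply]

end Character

section Semigroup

variable {h : Type*} [NormedAddCommGroup h] [InnerProductSpace ℂ h] [CompleteSpace h]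
  {Φ : ℝ≥0 → (h →L[ℂ] h) →CP (h →L[ℂ] h)} {ρ x : h →L[ℂ] h} {t₀ : ℝ≥0}

theorem exists_addChar_of_forall_exists_eq_smul (hadd : ∀ s t x, Φ (s + t) x = Φ s (Φ t x))
    (hx0 : x ≠ 0) (hx : ∀ t, ∃ c : ℂ, Φ t x = c • x) (ht₀ : Φ t₀ x = x) :
    ∃ ψ : AddChar ℝ≥0 ℂ, ∀ t, Φ t x = ψ t • x := by
  choose c hc using hx
  have hinj : Function.Injective fun a : ℂ => a • x := smul_left_injective ℂ hx0
  have hmul : ∀ s t, c (s + t) = c s * c t := fun s t => hinj <| by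
    dsimp only
    rw [← hc, hadd, hc t, map_smul, hc s, smul_smul, mul_comm]
  have hct₀ : c t₀ = 1 := hinj (by simp [← hc, ht₀])
  have hzero : c 0 = 1 := by simpa [hct₀] using (hmul 0 t₀).symm
  exact ⟨⟨c, hzero, hmul⟩, hc⟩

variable [FiniteDimensional ℂ h]

theorem IsIrreducibleFamily.addChar_eq_one (hΦ : IsIrreducibleFamily Φ) (hone : ∀ t, Φ t 1 = 1)
    (hρ : IsDensity ρ) (hinv : IsInvariantUnder Φ ρ) {ψ : AddChar ℝ≥0 ℂ}
    (hx : ∀ t, Φ t x = ψ t • x) (hx0 : x ≠ 0) (ht₀ : 0 < t₀) (hψ₀ : ψ t₀ = 1) : ψ = 1 := by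
  have hle : ∀ t, ‖ψ t‖ ≤ 1 := fun t => by
    refine le_of_mul_le_mul_right ?_ (norm_pos_iff.mpr hx0)
    rw [← norm_smul, ← hx, one_mul]
    exact norm_map_le (hone t) x
  obtain ⟨n, hn, hpow⟩ :=
    hΦ.exists_pow_eq_one hone hρ hinv (norm_addChar_eq_one hle ht₀ hψ₀) hx hx0
  exact addChar_eq_one_of_forall_pow_eq_one hn hpow

theorem IsIrreducibleFamily.exists_eq_smul_one_of_map_eq [Nontrivial h]
    (hΦ : IsIrreducibleFamily Φ) (hadd : ∀ s t x, Φ (s + t) x = Φ s (Φ t x))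
    (hone : ∀ t, Φ t 1 = 1) (hρ : IsDensity ρ) (hinv : IsInvariantUnder Φ ρ) (ht₀ : 0 < t₀)
    (hx : Φ t₀ x = x) : ∃ a : ℂ, x = a • 1 := by
  have hcomm : ∀ s t x, Φ s (Φ t x) = Φ t (Φ s x) := fun s t x => by
    rw [← hadd, ← hadd, add_comm]
  let W : Submodule ℂ (h →L[ℂ] h) :=
    LinearMap.eqLocus (Φ t₀).toLinearMap LinearMap.id ⊓ LinearMap.ker (traceForm ρ)
  have hmem : ∀ {y}, y ∈ W ↔ Φ t₀ y = y ∧ tr (ρ * y) = 0 := Iff.rfl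
  have hW : W = ⊥ := by
    by_contra hne
    obtain ⟨y, hyW, hy0, hy⟩ := exists_common_eigenvector (fun t => (Φ t).toLinearMap)
      (fun s t => LinearMap.ext (hcomm s t)) W hne fun t y hy =>
        hmem.mpr ⟨(hcomm t₀ t y).trans (congrArg (Φ t) hy.1), (hinv t y).trans hy.2⟩
    obtain ⟨hyfix, hytr⟩ := hmem.mp hyW
    obtain ⟨ψ, hψ⟩ := exists_addChar_of_forall_exists_eq_smul hadd hy0 hy hyfix
    have hψ₀ : ψ t₀ = 1 := smul_left_injective ℂ hy0 (by simp [← hψ, hyfix])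
    obtain rfl := hΦ.addChar_eq_one hone hρ hinv hψ hy0 ht₀ hψ₀
    obtain ⟨a, rfl⟩ := hΦ.exists_eq_smul_one hone hρ hinv fun t => by simpa using hψ t
    rw [mul_smul_comm, mul_one, tr_smul, hρ.2, mul_one] at hytr
    exact hy0 (by rw [hytr, zero_smul])
  have hxW : x - tr (ρ * x) • 1 ∈ W := hmem.mpr ⟨by rw [map_sub, map_smul, hone, hx], by
    rw [mul_sub, mul_smul_comm, mul_one, tr_sub, tr_smul, hρ.2, mul_one, sub_self]⟩
  rw [hW, Submodule.mem_bot, sub_eq_zero] at hxW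
  exact ⟨_, hxW⟩

theorem IsIrreducibleFamily.isIrreducibleMap [Nontrivial h] (hΦ : IsIrreducibleFamily Φ)
    (hadd : ∀ s t x, Φ (s + t) x = Φ s (Φ t x)) (hone : ∀ t, Φ t 1 = 1) (hρ : IsDensity ρ)
    (hinv : IsInvariantUnder Φ ρ) (ht₀ : 0 < t₀) : IsIrreducibleMap (Φ t₀) := by
  intro p hp hsub
  have hfix : p = Φ t₀ p :=
    eq_of_le_of_tr_mul_le hρ.1 (hΦ.isUnit_of_isDensity hone hρ hinv) hsub (hinv t₀ p).le
  obtain ⟨a, rfl⟩ := hΦ.exists_eq_smul_one_of_map_eq hadd hone hρ hinv ht₀ hfix.symm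
  have ha : IsIdempotentElem a := smul_left_injective ℂ (one_ne_zero (α := h →L[ℂ] h)) <| by
    simpa only [IsIdempotentElem, smul_mul_smul_comm, mul_one] using hp.isIdempotentElem
  exact (IsIdempotentElem.iff_eq_zero_or_one.mp ha).imp (by rintro rfl; exact zero_smul _ _)
    (by rintro rfl; exact one_smul _ _)

end Semigroup

end QuantumMarkov

theorem corollary3p5_general {h : Type*} [NormedAddCommGroup h] [InnerProductSpace ℂ h]
    [CompleteSpace h] [FiniteDimensional ℂ h] [Nontrivial h]
    (Φ : ℝ≥0 → (h →L[ℂ] h) →CP (h →L[ℂ] h)) (hadd : ∀ s t x, Φ (s + t) x = Φ s (Φ t x))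
    (hone : ∀ t, Φ t 1 = 1) :
    (∃ ρ : h →L[ℂ] h, QuantumMarkov.IsDensity ρ ∧ QuantumMarkov.IsInvariantUnder Φ ρ) ∧
    List.TFAE [
      QuantumMarkov.IsIrreducibleFamily Φ,
      QuantumMarkov.IsPrimitiveFamily Φ,
      ∀ t₀ : ℝ≥0, 0 < t₀ → QuantumMarkov.IsIrreducibleMap (Φ t₀),
      ∃ t₀ : ℝ≥0, 0 < t₀ ∧ QuantumMarkov.IsIrreducibleMap (Φ t₀)] := by
  have hcomm : ∀ s t x, Φ s (Φ t x) = Φ t (Φ s x) := fun s t x => by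
    rw [← hadd, ← hadd, add_comm]
  obtain ⟨ρ, hρ, hinv⟩ := QuantumMarkov.exists_isDensity_isInvariantUnder hcomm hone
  refine ⟨⟨ρ, hρ, hinv⟩, ?_⟩
  tfae_have 1 ↔ 2 := QuantumMarkov.isIrreducibleFamily_iff_isPrimitiveFamily hcomm hone
  tfae_have 1 → 3 := fun hΦ t₀ ht₀ => hΦ.isIrreducibleMap hadd hone hρ hinv ht₀
  tfae_have 3 → 4 := fun hΦ => ⟨1, one_pos, hΦ 1 one_pos⟩
  tfae_have 4 → 1 := fun ⟨t₀, _, hΦ⟩ p hp hsub => hΦ p hp (hsub t₀)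
  tfae_finish

theorem corollary3p5 {h : Type*} [NormedAddCommGroup h] [InnerProductSpace ℂ h]
    [CompleteSpace h] [FiniteDimensional ℂ h] [Nontrivial h] (T : QuantumMarkov.QMS h) :
    (∃ ρ : h →L[ℂ] h, QuantumMarkov.IsDensity ρ ∧ T.IsInvariant ρ) ∧
    List.TFAE [
      T.IsIrreducible,
      T.IsPrimitive,
      ∀ t₀ : ℝ≥0, 0 < t₀ → QuantumMarkov.IsIrreducibleMap (T.map t₀),
      ∃ t₀ : ℝ≥0, 0 < t₀ ∧ QuantumMarkov.IsIrreducibleMap (T.map t₀)] :=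
  corollary3p5_general T.map T.map_add T.map_one
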